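/- Let $0<q<\tfrac12$. Teams G and B play a match in which the goals are scored independently, each by team B with probability $q$ and by team G with probability $1-q$. For a positive integer $n$, Phase I lasts until team G has scored $n$ goals. If team B has scored at least $n$ goals by then, team B wins immediately, and the duration of Phase II is $0$. Otherwise Phase II begins: play continues until team B ties the score for the first time, in which case team B wins and the duration of Phase II is the number of goals scored in Phase II up to and including the tying goal; if the score is never tied, team B does not win. Let $E_n(q)$ be the conditional expectation of the duration of Phase II, given that team B wins (this event has positive probability, and the expectation is finite). Then, for each fixed $q$, as $n\to\infty$, $$E_n(q)\to\frac{1-q}{(1-2q)^2},$$ and more precisely $$E_n(q)=\frac{1-q}{(1-2q)^2}\Bigl(1-\frac{1}{(1-2q)^2}\cdot\frac1n-\frac{6q^2-6q-1}{(1-2q)^4}\cdot\frac1{n^2}-\frac{36q^4-72q^3+12q^2+24q+1}{(1-2q)^6}\cdot\frac1{n^3}-\frac{216q^6-648q^5+276q^4+528q^3-306q^2-66q-1}{(1-2q)^8}\cdot\frac1{n^4}\Bigr)+O\Bigl(\frac1{n^5}\Bigr).$$ -/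

import Mathlib

open MeasureTheory ProbabilityTheory Filter Topology Asymptotics

namespace SoccerMatch

/-! A match is recorded as a sequence `s : ℕ → Bool` of goals; `s k = true` means that goal number
`k` (counted from `0`) is scored by the bad team B, `s k = false` that it is scored by the good
team G. Time is measured in goals. -/

/-- The number of goals of team B among the first `t` goals. -/
def goalsB (s : ℕ → Bool) (t : ℕ) : ℕ := ((Finset.range t).filter (fun k => s k = true)).card

/-- The number of goals of team G among the first `t` goals. -/
def goalsG (s : ℕ → Bool) (t : ℕ) : ℕ := ((Finset.range t).filter (fun k => s k = false)).card

/-- The length of Phase I: the first time at which team G has `n` goals. (The value is only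
relevant if team G ever has `n` goals.) -/
noncomputable def phaseOneEnd (s : ℕ → Bool) (n : ℕ) : ℕ := sInf {t | goalsG s t = n}

/-- Team B wins: Phase I ends, and either team B has at least `n` goals by then, or
team B ties the score at some time of Phase II. -/
def TeamBWins (s : ℕ → Bool) (n : ℕ) : Prop :=
  (∃ t, goalsG s t = n) ∧
    (n ≤ goalsB s (phaseOneEnd s n) ∨
      ∃ k, goalsB s (phaseOneEnd s n + k) = goalsG s (phaseOneEnd s n + k))

open Classical in
/-- The duration of Phase II, in goals, of a match won by team B: it is `0` if team B has at least
`n` goals at the end of Phase I, and otherwise the number of goals in Phase II until the first tie.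
(The value is only relevant if team B wins.) -/
noncomputable def phaseTwoDuration (s : ℕ → Bool) (n : ℕ) : ℕ :=
  if n ≤ goalsB s (phaseOneEnd s n) then 0
  else sInf {k | goalsB s (phaseOneEnd s n + k) = goalsG s (phaseOneEnd s n + k)}

variable {Ω : Type*}

/-- The event that team B wins the random match `X`. -/
def winEvent (X : ℕ → Ω → Bool) (n : ℕ) : Set Ω := {ω | TeamBWins (fun k => X k ω) n}

/-- The duration of Phase II of the random match `X`, as a real random variable. -/
noncomputable def duration (X : ℕ → Ω → Bool) (n : ℕ) (ω : Ω) : ℝ :=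
  (phaseTwoDuration (fun k => X k ω) n : ℝ)

/-- The expected duration of Phase II, conditioned on the event that team B wins. -/
noncomputable def expectedDuration [MeasurableSpace Ω] (μ : Measure Ω) (X : ℕ → Ω → Bool)
    (n : ℕ) : ℝ :=
  ∫ ω, duration X n ω ∂(ProbabilityTheory.cond μ (winEvent X n))

end SoccerMatch

/-! Write n = m + 1, p = 1 - q, d = 1 - 2q. Phase I ends with j goals of B with probability C(m+j,
j) p^n q^j, and B is then n - j goals behind. For the biased walk, a deficit k is ever made up with
probability (q/p)^k, and the time this takes, integrated over that event, is k (q/p)^k / d; this is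
`hasSum_firstPassage` and `hasSum_mul_firstPassage`. Since p^n q^j (q/p)^(n-j) = q^n p^j, summing
over j gives finite sums. With H = ∑_{j≤m} C(m+j, j) p^j (`halfSum`), the comebacks contribute q^n H
to the probability that B wins, and the immediate wins contribute the same amount by `halfSum_symm`.
Hence `expectedDuration_eq`: E_n = ∑_{j≤m} (n-j) C(m+j, j) p^j / (2 d H).

Pascal's rule evaluates the numerator in terms of H and c = C(2m+1, m+1) p^n
(`one_sub_mul_sum_deficit`), so that E_n = n (1/R - d) / (2qd) with R = H/c. No asymptotics of H or
c separately are needed, because R satisfies the backward recurrence R_m = d + 4pq t_m R_{m+1} with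
t_m = (2m+3)/(2(m+2)) ≤ 1 (`halfSum_div_centralTerm`). As 4pq = 1 - d² < 1 and R is bounded
(`mul_halfSum_le`), the recurrence is a contraction coming from infinity: a polynomial in 1/n that
solves it up to O(n^-6) approximates dR up to O(n^-6) (`le_div_of_contraction`). The limit of dR is
1, so the factor n meets a difference that tends to 0 and costs one order; this is why dR is
expanded to fifth order to get E_n to fourth. -/

namespace SoccerMatch

/-! ### Partial sums of the negative binomial series -/

/-- The partial sum `∑_{j<k} (m+j choose j) p^j`. -/
def negBinSum (p : ℝ) (m k : ℕ) : ℝ := ∑ j ∈ Finset.range k, ((m + j).choose j : ℝ) * p ^ j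

/-- The partial sum of the negative binomial series that governs a match to `m + 1` goals. -/
def halfSum (p : ℝ) (m : ℕ) : ℝ := negBinSum p m (m + 1)

/-- The weighted central binomial coefficient to which `halfSum` is compared. -/
def centralTerm (p : ℝ) (m : ℕ) : ℝ := ((2 * m + 1).choose (m + 1) : ℝ) * p ^ (m + 1)

lemma negBinSum_succ (p : ℝ) (m k : ℕ) :
    negBinSum p m (k + 1) = negBinSum p m k + ((m + k).choose k : ℝ) * p ^ k :=
  Finset.sum_range_succ _ _

/-- Truncated form of (1 - p) (1 - p)^(-(m+2)) = (1 - p)^(-(m+1)); the last term is the boundary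
term of the truncation. The induction step is Pascal's rule. -/
lemma one_sub_mul_negBinSum (p : ℝ) (m k : ℕ) :
    (1 - p) * negBinSum p (m + 1) (k + 1) =
      negBinSum p m (k + 1) - ((m + k + 1).choose k : ℝ) * p ^ (k + 1) := by
  induction k with
  | zero => simp [negBinSum]
  | succ k ih =>
    rw [negBinSum_succ p (m + 1) (k + 1), mul_add, ih, negBinSum_succ p m (k + 1)]
    have h : (m + 1 + (k + 1)).choose (k + 1) =
        (m + (k + 1)).choose k + (m + (k + 1)).choose (k + 1) := by
      rw [show m + 1 + (k + 1) = m + (k + 1) + 1 by ring, Nat.choose_succ_succ]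
    have h' : (m + (k + 1) + 1).choose (k + 1) =
        (m + (k + 1)).choose k + (m + (k + 1)).choose (k + 1) := Nat.choose_succ_succ _ _
    rw [h, h', show m + k + 1 = m + (k + 1) by ring]
    push_cast
    ring

lemma choose_two_mul_add_two (m : ℕ) :
    (2 * m + 2).choose (m + 1) = 2 * (2 * m + 1).choose (m + 1) := by
  have h : (2 * m + 1).choose m = (2 * m + 1).choose (m + 1) := by
    rw [← Nat.choose_symm_of_eq_add]; omega
  rw [Nat.choose_succ_succ (2 * m + 1) m, h]; ring

lemma one_sub_mul_halfSum_succ (p : ℝ) (m : ℕ) :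
    (1 - p) * halfSum p (m + 1) = halfSum p m + (1 - 2 * p) * centralTerm p m := by
  have h := one_sub_mul_negBinSum p m (m + 1)
  rw [negBinSum_succ p m (m + 1)] at h
  rw [halfSum, h, halfSum, centralTerm, show m + (m + 1) = 2 * m + 1 by ring,
    choose_two_mul_add_two m]
  push_cast
  ring

lemma centralTerm_succ (p : ℝ) (m : ℕ) :
    ((m : ℝ) + 2) * centralTerm p (m + 1) = 2 * p * (2 * m + 3) * centralTerm p m := by
  have h1 : (2 * m + 3).choose (m + 2) * (m + 2) = (2 * m + 3) * (2 * m + 2).choose (m + 1) :=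
    (Nat.add_one_mul_choose_eq (2 * m + 2) (m + 1)).symm
  rw [choose_two_mul_add_two] at h1
  have h2 : (((2 * m + 3).choose (m + 2) : ℕ) : ℝ) * (m + 2) =
      (2 * m + 3) * (2 * ((2 * m + 1).choose (m + 1) : ℕ)) := by exact_mod_cast h1
  rw [centralTerm, centralTerm, show 2 * (m + 1) + 1 = 2 * m + 3 by ring,
    show m + 1 + 1 = m + 2 by ring]
  linear_combination p ^ (m + 2) * h2

/-- Absorption: (j+1) C(m+j+1, j+1) = (m+1) C(m+1+j, j). -/
lemma sum_mul_choose (p : ℝ) (m k : ℕ) :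
    ∑ j ∈ Finset.range (k + 1), (j : ℝ) * (((m + j).choose j : ℝ) * p ^ j) =
      (m + 1) * p * negBinSum p (m + 1) k := by
  rw [Finset.sum_range_succ', negBinSum, Finset.mul_sum]
  simp only [Nat.cast_zero, zero_mul, add_zero]
  refine Finset.sum_congr rfl fun j _ => ?_
  have h1 : (m + (j + 1)).choose (j + 1) * (j + 1) = (m + (j + 1)).choose j * (m + 1) := by
    rw [Nat.choose_succ_right_eq]; congr 1; omega
  have h2 : (((m + (j + 1)).choose (j + 1) : ℕ) : ℝ) * (j + 1) =
      ((m + (j + 1)).choose j : ℕ) * (m + 1) := by exact_mod_cast h1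
  rw [show m + 1 + j = m + (j + 1) by ring]
  push_cast
  linear_combination p ^ (j + 1) * h2

/-- Absorption turns the weight j into a negative binomial sum with m raised by one, and
`one_sub_mul_negBinSum` lowers it again. At p = 1 - q this evaluates the numerator of the expected
duration. -/
lemma one_sub_mul_sum_deficit (p : ℝ) (m : ℕ) :
    (1 - p) * ∑ j ∈ Finset.range (m + 1), ((m : ℝ) + 1 - j) * (((m + j).choose j : ℝ) * p ^ j) =
      (m + 1) * (centralTerm p m - (2 * p - 1) * halfSum p m) := by
  have h1 := sum_mul_choose p m m
  have h2 := one_sub_mul_negBinSum p m m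
  rw [negBinSum_succ p (m + 1) m] at h2
  have h3 : (m + 1 + m).choose m = (2 * m + 1).choose (m + 1) := by
    rw [show m + 1 + m = 2 * m + 1 by ring, ← Nat.choose_symm_of_eq_add]; omega
  rw [show m + m + 1 = m + 1 + m by ring, h3] at h2
  simp only [sub_mul _ _ (((m + _).choose _ : ℝ) * _), Finset.sum_sub_distrib, h1,
    ← Finset.mul_sum]
  rw [halfSum, centralTerm, ← negBinSum]
  linear_combination (-(m + 1) * p) * h2

lemma halfSum_pos {p : ℝ} (hp : 0 < p) (m : ℕ) : 0 < halfSum p m := by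
  unfold halfSum negBinSum
  refine Finset.sum_pos (fun j _ => mul_pos ?_ (pow_pos hp j)) (by simp)
  exact Nat.cast_pos.2 (Nat.choose_pos (Nat.le_add_left j m))

lemma centralTerm_pos {p : ℝ} (hp : 0 < p) (m : ℕ) : 0 < centralTerm p m :=
  mul_pos (by exact_mod_cast Nat.choose_pos (by omega)) (by positivity)

/-- As long as k ≤ m, each binomial coefficient is at least twice the preceding one, so the terms
grow at least by the factor 2p. For 2p > 1 the sum is dominated by a geometric series ending at its
last term. -/
lemma mul_negBinSum_le {p : ℝ} (hp : 0 < p) (m k : ℕ) (hk : k ≤ m) :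
    (2 * p - 1) * negBinSum p m (k + 1) ≤ 2 * p * (((m + k).choose k : ℝ) * p ^ k) := by
  induction k with
  | zero => simp [negBinSum]
  | succ k ih =>
    have h1 : (m + k + 1) * (m + k).choose k = (m + k + 1).choose (k + 1) * (k + 1) :=
      Nat.add_one_mul_choose_eq _ _
    have h2 : 2 * (m + k).choose k ≤ (m + (k + 1)).choose (k + 1) := by
      rw [← add_assoc]
      refine Nat.le_of_mul_le_mul_right ?_ (Nat.succ_pos k)
      calc 2 * (m + k).choose k * (k + 1) = 2 * (k + 1) * (m + k).choose k := by ring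
        _ ≤ (m + k + 1) * (m + k).choose k := Nat.mul_le_mul_right _ (by omega)
        _ = _ := h1
    have h3 : 2 * ((m + k).choose k : ℝ) ≤ ((m + (k + 1)).choose (k + 1) : ℝ) := by
      exact_mod_cast h2
    have h4 := mul_le_mul_of_nonneg_right h3 (pow_nonneg hp.le (k + 1))
    rw [negBinSum_succ, mul_add]
    have := ih (by omega)
    rw [pow_succ] at *
    linarith

lemma mul_halfSum_le {p : ℝ} (hp : 0 < p) (m : ℕ) :
    (2 * p - 1) * halfSum p m ≤ 2 * centralTerm p m := by
  have h1 : ((m + m).choose m : ℝ) ≤ ((2 * m + 1).choose (m + 1) : ℝ) := by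
    have : (2 * m + 1).choose (m + 1) = (2 * m).choose m + (2 * m).choose (m + 1) :=
      Nat.choose_succ_succ _ _
    rw [← two_mul, this]; push_cast; linarith [Nat.cast_nonneg (α := ℝ) ((2 * m).choose (m + 1))]
  have h2 := mul_le_mul_of_nonneg_right h1 (pow_nonneg hp.le (m + 1))
  have h3 := mul_negBinSum_le hp m m le_rfl
  rw [halfSum, centralTerm]
  rw [pow_succ] at *
  linarith

/-- For probabilities p and q: exactly one of the two teams is the first to reach m + 1 goals, and
the two summands are the probabilities of these events. In the induction the corrections cancel,
because 1 - 2p and 1 - 2q are opposite. -/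
lemma halfSum_symm {p q : ℝ} (h : p + q = 1) (m : ℕ) :
    q ^ (m + 1) * halfSum p m + p ^ (m + 1) * halfSum q m = 1 := by
  induction m with
  | zero => simp [halfSum, negBinSum, add_comm q p, h]
  | succ m ih =>
    have h1 := one_sub_mul_halfSum_succ p m
    have h2 := one_sub_mul_halfSum_succ q m
    rw [show 1 - p = q by linarith] at h1
    rw [show 1 - q = p by linarith] at h2
    obtain rfl : p = 1 - q := by linarith
    rw [pow_succ q (m + 1), pow_succ (1 - q) (m + 1), mul_assoc, mul_assoc, h1, h2,
      centralTerm, centralTerm]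
    linear_combination ih

/-! ### Asymptotic expansion -/

/-- Iterating the inequality l times pushes the a priori bound M out to index n + l with weight θ^l.
The source terms decrease in n, so they add up to at most a geometric series; then l → ∞. -/
lemma le_div_of_contraction {θ C M : ℝ} (hθ0 : 0 ≤ θ) (hθ : θ < 1) (hC : 0 ≤ C) (k : ℕ)
    (e : ℕ → ℝ) (hM : ∀ n, e n ≤ M)
    (h : ∀ n, e n ≤ θ * e (n + 1) + C / ((n : ℝ) + 1) ^ k) (n : ℕ) :
    e n ≤ C / (1 - θ) / ((n : ℝ) + 1) ^ k := by
  have hθ' : 0 < 1 - θ := by linarith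
  have key : ∀ l n : ℕ, e n ≤ θ ^ l * M + C / (1 - θ) / ((n : ℝ) + 1) ^ k := by
    intro l
    induction l with
    | zero =>
      intro n
      have : 0 ≤ C / (1 - θ) / ((n : ℝ) + 1) ^ k := by positivity
      linarith [hM n]
    | succ l ih =>
      intro n
      have h1 := mul_le_mul_of_nonneg_left (ih (n + 1)) hθ0
      have h2 : C / (1 - θ) / (((n + 1 : ℕ) : ℝ) + 1) ^ k ≤ C / (1 - θ) / ((n : ℝ) + 1) ^ k := by
        gcongr; simp
      have h3 := mul_le_mul_of_nonneg_left h2 hθ0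
      have h4 : θ * (C / (1 - θ) / ((n : ℝ) + 1) ^ k) + C / ((n : ℝ) + 1) ^ k =
          C / (1 - θ) / ((n : ℝ) + 1) ^ k := by
        field_simp; ring
      calc e n ≤ θ * e (n + 1) + C / ((n : ℝ) + 1) ^ k := h n
        _ ≤ θ ^ (l + 1) * M + (θ * (C / (1 - θ) / ((n : ℝ) + 1) ^ k) + C / ((n : ℝ) + 1) ^ k) := by
          rw [pow_succ]; linarith
        _ = _ := by rw [h4]
  have hlim : Tendsto (fun l : ℕ => θ ^ l * M + C / (1 - θ) / ((n : ℝ) + 1) ^ k) atTop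
      (𝓝 (0 * M + C / (1 - θ) / ((n : ℝ) + 1) ^ k)) :=
    ((tendsto_pow_atTop_nhds_zero_of_lt_one hθ0 hθ).mul_const M).add_const _
  rw [zero_mul, zero_add] at hlim
  exact ge_of_tendsto' hlim fun l => key l n

/-- The expansion, to fifth order in `x = 1/n`, of `d` times the ratio of `halfSum` to
`centralTerm`, where `d = 1 - 2q`. -/
noncomputable def ratioApprox (d x : ℝ) : ℝ :=
  1 + (1 / 2 - 1 / 2 / d ^ 2) * x + (1 / 4 - 1 / d ^ 2 + 3 / 4 / d ^ 4) * x ^ 2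
    + (1 / 8 - 13 / 8 / d ^ 2 + 27 / 8 / d ^ 4 - 15 / 8 / d ^ 6) * x ^ 3
    + (1 / 16 - 5 / 2 / d ^ 2 + 87 / 8 / d ^ 4 - 15 / d ^ 6 + 105 / 16 / d ^ 8) * x ^ 4
    + (1 / 32 - 121 / 32 / d ^ 2 + 495 / 16 / d ^ 4 - 1275 / 16 / d ^ 6 + 2625 / 32 / d ^ 8
        - 945 / 32 / d ^ 10) * x ^ 5

lemma exists_abs_le_of_continuousOn {f : ℝ → ℝ} (hf : ContinuousOn f (Set.Icc 0 1)) :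
    ∃ C, 0 ≤ C ∧ ∀ x, 0 ≤ x → x ≤ 1 → |f x| ≤ C := by
  obtain ⟨C, hC⟩ := isCompact_Icc.exists_bound_of_continuousOn hf
  exact ⟨C, (norm_nonneg _).trans (hC 0 (by simp)), fun x h0 h1 => hC x ⟨h0, h1⟩⟩

/-- With x = 1/(m+1), passing from m to m + 1 is x ↦ x/(1+x), and t_m = (1 + x/2)/(1 + x). The
coefficients of `ratioApprox` are those for which the residual of the recurrence vanishes through
order x^5. -/
lemma exists_ratioApprox_residual_le {d : ℝ} (hd : d ≠ 0) :
    ∃ C, 0 ≤ C ∧ ∀ x, 0 ≤ x → x ≤ 1 →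
      |ratioApprox d x - d ^ 2 -
        (1 - d ^ 2) * ((1 + x / 2) / (1 + x)) * ratioApprox d (x / (1 + x))| ≤ C * x ^ 6 := by
  -- The exact quotient of the residual by x^6.
  let Q : ℝ → ℝ := fun x => (
      (-1 / 64 * d ^ 2 + 91 / 16 - 5313 / 64 / d ^ 2 + 1425 / 4 / d ^ 4 - 41475 / 64 / d ^ 6 +
        8505 / 16 / d ^ 8 - 10395 / 64 / d ^ 10)
      + (179 / 32 - 4403 / 32 / d ^ 2 + 11787 / 16 / d ^ 4 - 24375 / 16 / d ^ 6 + 43575 / 32 / d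
        ^ 8 - 14175 / 32 / d ^ 10) * x
      + (41 / 16 - 991 / 8 / d ^ 2 + 6423 / 8 / d ^ 4 - 1830 / d ^ 6 + 27825 / 16 / d ^ 8 - 4725
        / 8 / d ^ 10) * x ^ 2
      + (31 / 32 - 2347 / 32 / d ^ 2 + 8523 / 16 / d ^ 4 - 20595 / 16 / d ^ 6 + 40635 / 32 / d ^
        8 - 14175 / 32 / d ^ 10) * x ^ 3
      + (1 / 4 - 403 / 16 / d ^ 2 + 393 / 2 / d ^ 4 - 3945 / 8 / d ^ 6 + 1995 / 4 / d ^ 8 - 2835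
        / 16 / d ^ 10) * x ^ 4
      + (1 / 32 - 121 / 32 / d ^ 2 + 495 / 16 / d ^ 4 - 1275 / 16 / d ^ 6 + 2625 / 32 / d ^ 8 -
        945 / 32 / d ^ 10) * x ^ 5) / (1 + x) ^ 6
  have hQ : ContinuousOn Q (Set.Icc 0 1) := by
    refine ContinuousOn.div (by fun_prop) (by fun_prop) fun x hx => ?_
    have : 0 < 1 + x := by linarith [hx.1]
    positivity
  obtain ⟨C, hC0, hC⟩ := exists_abs_le_of_continuousOn hQ
  refine ⟨C, hC0, fun x h0 h1 => ?_⟩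
  have hx : 1 + x ≠ 0 := by positivity
  have key : ratioApprox d x - d ^ 2 -
      (1 - d ^ 2) * ((1 + x / 2) / (1 + x)) * ratioApprox d (x / (1 + x)) = Q x * x ^ 6 := by
    simp only [ratioApprox, Q]
    field_simp
    ring
  rw [key, abs_mul, abs_of_nonneg (pow_nonneg h0 6)]
  exact mul_le_mul_of_nonneg_right (hC x h0 h1) (by positivity)

/-- The asymptotic expansion, to fourth order in `x = 1/n`, of the expected duration. -/
noncomputable def durationApprox (q x : ℝ) : ℝ :=
  (1 - q) / (1 - 2 * q) ^ 2 *
    (1 - 1 / (1 - 2 * q) ^ 2 * x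
      - (6 * q ^ 2 - 6 * q - 1) / (1 - 2 * q) ^ 4 * x ^ 2
      - (36 * q ^ 4 - 72 * q ^ 3 + 12 * q ^ 2 + 24 * q + 1) / (1 - 2 * q) ^ 6 * x ^ 3
      - (216 * q ^ 6 - 648 * q ^ 5 + 276 * q ^ 4 + 528 * q ^ 3 - 306 * q ^ 2 - 66 * q - 1)
          / (1 - 2 * q) ^ 8 * x ^ 4)

/-- The relation E = n (1/R - d) / (2qd) reads dR (1 + 2q x E) = 1 with x = 1/n and 2q = 1 - d. The
two approximations satisfy it through order x^5. -/
lemma exists_one_sub_ratioApprox_mul_le {d : ℝ} (hd : d ≠ 0) :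
    ∃ C, 0 ≤ C ∧ ∀ x, 0 ≤ x → x ≤ 1 →
      |1 - ratioApprox d x * (1 + (1 - d) * x * durationApprox ((1 - d) / 2) x)| ≤ C * x ^ 6 := by
  let Q : ℝ → ℝ := fun x =>
      (1 / 64 - 101 / 32 / d ^ 2 + 2103 / 64 / d ^ 4 - 1815 / 16 / d ^ 6 + 11247 / 64 / d ^ 8 -
        4061 / 32 / d ^ 10 + 2233 / 64 / d ^ 12)
      + (-5 / 8 / d ^ 2 + 205 / 16 / d ^ 4 - 1263 / 16 / d ^ 6 + 1707 / 8 / d ^ 8 - 1145 / 4 / d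
        ^ 10 + 3005 / 16 / d ^ 12 - 771 / 16 / d ^ 14) * x
      + (-39 / 128 / d ^ 2 + 1427 / 128 / d ^ 4 - 13031 / 128 / d ^ 6 + 50763 / 128 / d ^ 8 -
        101597 / 128 / d ^ 10 + 110033 / 128 / d ^ 12 - 61461 / 128 / d ^ 14 + 13905 / 128 / d ^
        16) * x ^ 2
      + (-9 / 64 / d ^ 2 + 1257 / 128 / d ^ 4 - 16235 / 128 / d ^ 6 + 87845 / 128 / d ^ 8 -
        247939 / 128 / d ^ 10 + 396571 / 128 / d ^ 12 - 362961 / 128 / d ^ 14 + 177495 / 128 / d ^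
        16 - 36015 / 128 / d ^ 18) * x ^ 3
      + (-27 / 512 / d ^ 2 + 3561 / 512 / d ^ 4 - 15789 / 128 / d ^ 6 + 115985 / 128 / d ^ 8 -
        888953 / 256 / d ^ 10 + 1970599 / 256 / d ^ 12 - 1313925 / 128 / d ^ 14 + 1041885 / 128 /
        d ^ 16 - 1813035 / 512 / d ^ 18 + 333585 / 512 / d ^ 20) * x ^ 4
  obtain ⟨C, hC0, hC⟩ := exists_abs_le_of_continuousOn (f := Q) (by fun_prop)
  refine ⟨C, hC0, fun x h0 h1 => ?_⟩
  have key : 1 - ratioApprox d x * (1 + (1 - d) * x * durationApprox ((1 - d) / 2) x) =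
      Q x * x ^ 6 := by
    simp only [ratioApprox, durationApprox, Q, show 1 - 2 * ((1 - d) / 2) = d by ring]
    field_simp
    ring
  rw [key, abs_mul, abs_of_nonneg (pow_nonneg h0 6)]
  exact mul_le_mul_of_nonneg_right (hC x h0 h1) (by positivity)

/-- `one_sub_mul_halfSum_succ` divided by the central term, whose growth factor is given by
`centralTerm_succ`. -/
lemma halfSum_div_centralTerm {q : ℝ} (hq0 : 0 < q) (hq : q < 1 / 2) (m : ℕ) :
    halfSum (1 - q) m / centralTerm (1 - q) m = (1 - 2 * q) +
      4 * (1 - q) * q * ((2 * m + 3) / (2 * (m + 2))) *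
        (halfSum (1 - q) (m + 1) / centralTerm (1 - q) (m + 1)) := by
  have hp : 0 < 1 - q := by linarith
  have hc := centralTerm_pos hp m
  have hc' := centralTerm_pos hp (m + 1)
  have h1 := one_sub_mul_halfSum_succ (1 - q) m
  have h2 := centralTerm_succ (1 - q) m
  have h3 : centralTerm (1 - q) (m + 1) =
      2 * (1 - q) * (2 * m + 3) * centralTerm (1 - q) m / (m + 2) := by
    field_simp; linarith
  have h4 : halfSum (1 - q) m = q * halfSum (1 - q) (m + 1) +
      (1 - 2 * q) * centralTerm (1 - q) m := by linear_combination -h1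
  rw [h3, h4]
  field_simp
  ring

lemma exists_abs_ratio_sub_le {q : ℝ} (hq0 : 0 < q) (hq : q < 1 / 2) :
    ∃ C, 0 ≤ C ∧ ∀ m : ℕ,
      |(1 - 2 * q) * (halfSum (1 - q) m / centralTerm (1 - q) m) -
        ratioApprox (1 - 2 * q) (1 / ((m : ℝ) + 1))| ≤ C / ((m : ℝ) + 1) ^ 6 := by
  set d := 1 - 2 * q with hd
  have hd0 : 0 < d := by linarith
  have hd1 : d < 1 := by linarith
  have hp : 0 < 1 - q := by linarith
  have hsq : d ^ 2 < 1 := by nlinarith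
  obtain ⟨C, hC0, hC⟩ := exists_ratioApprox_residual_le hd0.ne'
  obtain ⟨M, -, hM⟩ := exists_abs_le_of_continuousOn (f := ratioApprox d)
    (by unfold ratioApprox; fun_prop)
  have hx0 (m : ℕ) : 0 ≤ 1 / ((m : ℝ) + 1) := by positivity
  have hx1 (m : ℕ) : 1 / ((m : ℝ) + 1) ≤ 1 := by
    rw [div_le_one (by positivity)]; linarith [Nat.cast_nonneg (α := ℝ) m]
  refine ⟨C / (1 - (1 - d ^ 2)), div_nonneg hC0 (by nlinarith), ?_⟩
  -- The a priori bound is 2 for d times the ratio, from `mul_halfSum_le`, plus M for the polynomial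
  -- on [0, 1].
  refine le_div_of_contraction (θ := 1 - d ^ 2) (M := 2 + M) (by linarith) (by nlinarith)
    hC0 6 _ (fun m => ?_) fun m => ?_
  · have h1 : d * (halfSum (1 - q) m / centralTerm (1 - q) m) ≤ 2 := by
      rw [← mul_div_assoc, div_le_iff₀ (centralTerm_pos hp m)]
      have := mul_halfSum_le hp m
      rwa [show 2 * (1 - q) - 1 = d by rw [hd]; ring] at this
    have h0 : 0 ≤ d * (halfSum (1 - q) m / centralTerm (1 - q) m) :=
      mul_nonneg hd0.le (div_pos (halfSum_pos hp m) (centralTerm_pos hp m)).le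
    refine (abs_sub _ _).trans ?_
    rw [abs_of_nonneg h0]
    exact add_le_add h1 (hM _ (hx0 m) (hx1 m))
  · have hres := hC _ (hx0 m) (hx1 m)
    have e1 : 1 / ((m : ℝ) + 1) / (1 + 1 / ((m : ℝ) + 1)) = 1 / (((m + 1 : ℕ) : ℝ) + 1) := by
      push_cast; field_simp
    have e2 : (1 + 1 / ((m : ℝ) + 1) / 2) / (1 + 1 / ((m : ℝ) + 1)) =
        (2 * m + 3) / (2 * (m + 2)) := by
      field_simp; ring
    rw [e1, e2, one_div_pow, mul_one_div] at hres
    rw [halfSum_div_centralTerm hq0 hq m,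
      show 4 * (1 - q) * q = 1 - d ^ 2 by rw [hd]; ring, ← hd]
    set a := halfSum (1 - q) (m + 1) / centralTerm (1 - q) (m + 1)
    set r := ratioApprox d (1 / (((m + 1 : ℕ) : ℝ) + 1))
    set r' := ratioApprox d (1 / ((m : ℝ) + 1))
    set t : ℝ := (2 * m + 3) / (2 * (m + 2))
    have ht0 : 0 ≤ t := by positivity
    have ht1 : t ≤ 1 := by
      rw [div_le_one (by positivity)]; linarith
    have : d * (d + (1 - d ^ 2) * t * a) - r' =
        (1 - d ^ 2) * t * (d * a - r) - (r' - d ^ 2 - (1 - d ^ 2) * t * r) := by ring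
    rw [this]
    refine (abs_sub _ _).trans (add_le_add ?_ hres)
    rw [abs_mul, abs_mul, abs_of_nonneg ht0, abs_of_nonneg (show 0 ≤ 1 - d ^ 2 by linarith),
      mul_assoc]
    exact mul_le_mul_of_nonneg_left (mul_le_of_le_one_left (abs_nonneg _) ht1) (by linarith)

/-- The closed form of the expected duration of Phase II of a match to `m + 1` goals. -/
noncomputable def meanDuration (q : ℝ) (m : ℕ) : ℝ :=
  (∑ j ∈ Finset.range (m + 1), ((m : ℝ) + 1 - j) * (((m + j).choose j : ℝ) * (1 - q) ^ j)) /
    (2 * (1 - 2 * q) * halfSum (1 - q) m)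

theorem exists_abs_meanDuration_sub_le {q : ℝ} (hq0 : 0 < q) (hq : q < 1 / 2) :
    ∃ C, 0 ≤ C ∧ ∀ m : ℕ, |meanDuration q m - durationApprox q (1 / ((m : ℝ) + 1))| ≤
      C * (1 / ((m : ℝ) + 1) ^ 5) := by
  obtain ⟨C₁, hC₁, h₁⟩ := exists_abs_ratio_sub_le hq0 hq
  have hd0 : 0 < 1 - 2 * q := by linarith
  have hp : 0 < 1 - q := by linarith
  obtain ⟨C₂, hC₂, h₂⟩ := exists_one_sub_ratioApprox_mul_le hd0.ne'
  obtain ⟨B, hB, hb⟩ := exists_abs_le_of_continuousOn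
    (f := fun x => 1 + 2 * q * x * durationApprox q x) (by unfold durationApprox; fun_prop)
  refine ⟨(C₁ * B + C₂) / (2 * q * (1 - 2 * q) ^ 2), by positivity, fun m => ?_⟩
  have hx0 : 0 ≤ 1 / ((m : ℝ) + 1) := by positivity
  have hx1 : 1 / ((m : ℝ) + 1) ≤ 1 := by
    rw [div_le_one (by positivity)]; linarith [Nat.cast_nonneg (α := ℝ) m]
  have hH := halfSum_pos hp m
  have hc := centralTerm_pos hp m
  have hsum := one_sub_mul_sum_deficit (1 - q) m
  -- This lower bound lets R in the denominator be replaced by 1 - 2q, which produces the square in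
  -- the constant.
  have hR : 1 - 2 * q ≤ halfSum (1 - q) m / centralTerm (1 - q) m := by
    rw [halfSum_div_centralTerm hq0 hq m]
    have := div_pos (halfSum_pos hp (m + 1)) (centralTerm_pos hp (m + 1))
    have : 0 ≤ 4 * (1 - q) * q * ((2 * m + 3) / (2 * (m + 2))) *
        (halfSum (1 - q) (m + 1) / centralTerm (1 - q) (m + 1)) := by positivity
    linarith
  have g₁ := h₁ m
  have g₂ := h₂ _ hx0 hx1
  have gb := hb _ hx0 hx1
  rw [show 1 - (1 - 2 * q) = 2 * q by ring, show 2 * q / 2 = q by ring] at g₂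
  have hmean : meanDuration q m = ((m : ℝ) + 1) / (2 * q * (1 - 2 * q)) *
      (1 / (halfSum (1 - q) m / centralTerm (1 - q) m) - (1 - 2 * q)) := by
    have : ∑ j ∈ Finset.range (m + 1), ((m : ℝ) + 1 - j) *
        (((m + j).choose j : ℝ) * (1 - q) ^ j) =
        (m + 1) * (centralTerm (1 - q) m - (1 - 2 * q) * halfSum (1 - q) m) / q := by
      rw [eq_div_iff hq0.ne']
      linear_combination hsum
    rw [meanDuration, this]
    field_simp
  rw [hmean]
  set R := halfSum (1 - q) m / centralTerm (1 - q) m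
  have hR0 : 0 < R := hd0.trans_le hR
  set r := ratioApprox (1 - 2 * q) (1 / ((m : ℝ) + 1))
  set A := durationApprox q (1 / ((m : ℝ) + 1))
  set x := 1 / ((m : ℝ) + 1) with hx
  have hnx : ((m : ℝ) + 1) * x = 1 := by rw [hx]; field_simp
  -- The error splits into the defect of the approximate relation between r and A and the error of r
  -- as an approximation of (1 - 2q) R; both are O(x^6), and the prefactor is O(1/x).
  have key : ((m : ℝ) + 1) / (2 * q * (1 - 2 * q)) * (1 / R - (1 - 2 * q)) - A =
      ((m : ℝ) + 1) / (2 * q * (1 - 2 * q) * R) *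
        ((1 - r * (1 + 2 * q * x * A)) - ((1 - 2 * q) * R - r) * (1 + 2 * q * x * A)) := by
    field_simp
    linear_combination (2 * q * (1 - 2 * q) * R * A) * hnx
  have hpos : 0 < ((m : ℝ) + 1) / (2 * q * (1 - 2 * q) * R) := by positivity
  rw [key, abs_mul, abs_of_pos hpos]
  calc _ ≤ ((m : ℝ) + 1) / (2 * q * (1 - 2 * q) * (1 - 2 * q)) *
        (C₂ * x ^ 6 + C₁ / ((m : ℝ) + 1) ^ 6 * B) := by
        refine mul_le_mul ?_ ?_ (abs_nonneg _) (by positivity)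
        · gcongr
        · refine (abs_sub _ _).trans (add_le_add g₂ ?_)
          rw [abs_mul]
          exact mul_le_mul g₁ gb (abs_nonneg _) (by positivity)
    _ = _ := by
        rw [hx]; field_simp; ring

/-! ### First passage of the biased random walk -/

/-- The probability that a random walk with steps `-1` (with probability `q`) and `+1` (with
probability `1 - q`), started at `d`, first visits `0` at time `k`. -/
def firstPassage (q : ℝ) : ℕ → ℕ → ℝ
  | 0, 0 => 1
  | 0, _ + 1 => 0
  | _ + 1, 0 => 0
  | k + 1, d + 1 => q * firstPassage q k d + (1 - q) * firstPassage q k (d + 2)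

lemma firstPassage_nonneg {q : ℝ} (hq0 : 0 ≤ q) (hq1 : q ≤ 1) (k d : ℕ) :
    0 ≤ firstPassage q k d := by
  induction k generalizing d with
  | zero => cases d <;> simp [firstPassage]
  | succ k ih =>
    cases d with
    | zero => simp [firstPassage]
    | succ d =>
      exact add_nonneg (mul_nonneg hq0 (ih d)) (mul_nonneg (by linarith) (ih (d + 2)))

/-- The homogeneous gambler's ruin recurrence has no nonzero solution that vanishes at `0` and at
infinity. -/
lemma eq_zero_of_ruin_recurrence {q : ℝ} (hq0 : 0 < q) (hq : q < 1 / 2) {e : ℕ → ℝ}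
    (h0 : e 0 = 0) (hrec : ∀ d, e (d + 1) = q * e d + (1 - q) * e (d + 2))
    (hlim : Tendsto e atTop (𝓝 0)) (d : ℕ) : e d = 0 := by
  have hp : 0 < 1 - q := by linarith
  set r := q / (1 - q) with hr
  have hr0 : 0 ≤ r := by positivity
  have hr1 : r < 1 := by rw [hr, div_lt_one hp]; linarith
  -- The increments are geometric with ratio r < 1, so e converges to e 1 / (1 - r). As the limit is
  -- 0, e 1 = 0.
  have hdiff : ∀ d, e (d + 1) - e d = e 1 * r ^ d := by
    intro d
    induction d with
    | zero => simp [h0]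
    | succ d ih =>
      have h1 : (1 - q) * (e (d + 1 + 1) - e (d + 1)) = q * (e (d + 1) - e d) := by
        linear_combination -hrec d
      have h2 : e (d + 1 + 1) - e (d + 1) = r * (e (d + 1) - e d) := by
        rw [hr]; field_simp; linarith
      rw [h2, ih]; ring
  have hsum : ∀ d, e d = e 1 * ∑ i ∈ Finset.range d, r ^ i := by
    intro d
    rw [Finset.mul_sum, ← Finset.sum_congr rfl fun i _ => hdiff i, Finset.sum_range_sub, h0,
      sub_zero]
  have hgeo := ((hasSum_geometric_of_lt_one hr0 hr1).tendsto_sum_nat).const_mul (e 1)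
  have h1 : e 1 * (1 - r)⁻¹ = 0 :=
    tendsto_nhds_unique (hgeo.congr fun d => (hsum d).symm) hlim
  have h2 : e 1 = 0 := by
    rcases mul_eq_zero.1 h1 with h | h
    · exact h
    · exact absurd h (inv_ne_zero (by linarith))
  rw [hsum d, h2, zero_mul]

lemma ruin_pow_recurrence {q : ℝ} (hq : q < 1 / 2) (d : ℕ) :
    (q / (1 - q)) ^ (d + 1) = q * (q / (1 - q)) ^ d + (1 - q) * (q / (1 - q)) ^ (d + 2) := by
  have hp : 0 < 1 - q := by linarith
  rw [pow_add _ d 2, pow_succ]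
  field_simp
  ring

/-- First-step analysis of the time to a tie, integrated over the event of a tie: the step just
taken adds 1 on that event, hence the source term (q/(1-q))^(d+1). -/
lemma ruin_mean_recurrence {q : ℝ} (hq : q < 1 / 2) (d : ℕ) :
    ((d + 1 : ℕ) : ℝ) * (q / (1 - q)) ^ (d + 1) / (1 - 2 * q) =
      q * ((d : ℝ) * (q / (1 - q)) ^ d / (1 - 2 * q)) +
      (1 - q) * (((d + 2 : ℕ) : ℝ) * (q / (1 - q)) ^ (d + 2) / (1 - 2 * q)) +
      (q / (1 - q)) ^ (d + 1) := by
  have hp : 0 < 1 - q := by linarith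
  have hd : 0 < 1 - 2 * q := by linarith
  have hr : (1 - q) * (q / (1 - q)) = q := by field_simp
  have hi : (1 - 2 * q) * (1 - 2 * q)⁻¹ = 1 := mul_inv_cancel₀ hd.ne'
  simp only [div_eq_mul_inv _ (1 - 2 * q)]
  generalize q / (1 - q) = r at hr
  generalize (1 - 2 * q)⁻¹ = i at hi
  push_cast
  linear_combination (d * r ^ d * i - (d + 2) * r ^ (d + 1) * i) * hr + r ^ (d + 1) * hi

/-- The closed form solves the first-step recurrence, so it bounds every finite-horizon sum by
induction on the horizon. This gives summability, and decay in d for the uniqueness argument. -/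
lemma sum_firstPassage_le {q : ℝ} (hq0 : 0 < q) (hq : q < 1 / 2) (N d : ℕ) :
    ∑ k ∈ Finset.range N, firstPassage q k d ≤ (q / (1 - q)) ^ d := by
  have hp : 0 < 1 - q := by linarith
  induction N generalizing d with
  | zero => simp only [Finset.range_zero, Finset.sum_empty]; positivity
  | succ N ih =>
    rw [Finset.sum_range_succ']
    cases d with
    | zero => simp [firstPassage]
    | succ d =>
      simp only [firstPassage, add_zero, Finset.sum_add_distrib, ← Finset.mul_sum]
      rw [ruin_pow_recurrence hq]
      exact add_le_add (mul_le_mul_of_nonneg_left (ih d) hq0.le)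
        (mul_le_mul_of_nonneg_left (ih (d + 2)) hp.le)

lemma sum_mul_firstPassage_le {q : ℝ} (hq0 : 0 < q) (hq : q < 1 / 2) (N d : ℕ) :
    ∑ k ∈ Finset.range N, (k : ℝ) * firstPassage q k d ≤
      (d : ℝ) * (q / (1 - q)) ^ d / (1 - 2 * q) := by
  have hp : 0 < 1 - q := by linarith
  have hd : 0 < 1 - 2 * q := by linarith
  induction N generalizing d with
  | zero => simp only [Finset.range_zero, Finset.sum_empty]; positivity
  | succ N ih =>
    cases d with
    | zero => rw [Finset.sum_range_succ']; simp [firstPassage]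
    | succ d =>
      have h1 := sum_firstPassage_le hq0 hq (N + 1) (d + 1)
      rw [Finset.sum_range_succ'] at h1 ⊢
      simp only [firstPassage, add_zero, Nat.cast_zero, mul_zero] at h1 ⊢
      rw [ruin_mean_recurrence hq]
      have h2 : ∑ k ∈ Finset.range N, ((k + 1 : ℕ) : ℝ) *
          (q * firstPassage q k d + (1 - q) * firstPassage q k (d + 2)) =
          q * ∑ k ∈ Finset.range N, (k : ℝ) * firstPassage q k d +
          (1 - q) * ∑ k ∈ Finset.range N, (k : ℝ) * firstPassage q k (d + 2) +
          ∑ k ∈ Finset.range N,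
            (q * firstPassage q k d + (1 - q) * firstPassage q k (d + 2)) := by
        rw [Finset.mul_sum, Finset.mul_sum, ← Finset.sum_add_distrib, ← Finset.sum_add_distrib]
        refine Finset.sum_congr rfl fun k _ => ?_
        push_cast; ring
      rw [h2]
      exact add_le_add (add_le_add (mul_le_mul_of_nonneg_left (ih d) hq0.le)
        (mul_le_mul_of_nonneg_left (ih (d + 2)) hp.le)) h1

lemma ruin_ratio_mem {q : ℝ} (hq0 : 0 < q) (hq : q < 1 / 2) :
    0 < q / (1 - q) ∧ q / (1 - q) < 1 := by
  have hp : 0 < 1 - q := by linarith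
  exact ⟨by positivity, by rw [div_lt_one hp]; linarith⟩

theorem hasSum_firstPassage {q : ℝ} (hq0 : 0 < q) (hq : q < 1 / 2) (d : ℕ) :
    HasSum (fun k => firstPassage q k d) ((q / (1 - q)) ^ d) := by
  obtain ⟨hr0, hr1⟩ := ruin_ratio_mem hq0 hq
  have hnn := firstPassage_nonneg hq0.le (by linarith : q ≤ 1)
  have hs (d : ℕ) : Summable (fun k => firstPassage q k d) :=
    summable_of_sum_range_le (fun k => hnn k d) fun N => sum_firstPassage_le hq0 hq N d
  have hle (d : ℕ) : ∑' k, firstPassage q k d ≤ (q / (1 - q)) ^ d :=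
    (hs d).tsum_le_of_sum_range_le fun N => sum_firstPassage_le hq0 hq N d
  have hlim := tendsto_pow_atTop_nhds_zero_of_lt_one hr0.le hr1
  -- The gap between the closed form and the series solves the homogeneous recurrence, vanishes at d
  -- = 0, and lies between 0 and the closed form, which tends to 0.
  have he := eq_zero_of_ruin_recurrence hq0 hq
    (e := fun d => (q / (1 - q)) ^ d - ∑' k, firstPassage q k d) ?_ (fun d => ?_) ?_ d
  · rw [sub_eq_zero.1 he]; exact (hs d).hasSum
  · rw [(hs 0).tsum_eq_zero_add]; simp [firstPassage]
  · rw [(hs (d + 1)).tsum_eq_zero_add, ruin_pow_recurrence hq]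
    simp only [firstPassage]
    rw [((hs d).mul_left q).tsum_add ((hs (d + 2)).mul_left (1 - q)), tsum_mul_left, tsum_mul_left]
    ring
  · exact squeeze_zero (fun d => sub_nonneg.2 (hle d))
      (fun d => sub_le_self _ (tsum_nonneg fun k => hnn k d)) hlim

theorem hasSum_mul_firstPassage {q : ℝ} (hq0 : 0 < q) (hq : q < 1 / 2) (d : ℕ) :
    HasSum (fun k : ℕ => (k : ℝ) * firstPassage q k d)
      ((d : ℝ) * (q / (1 - q)) ^ d / (1 - 2 * q)) := by
  obtain ⟨hr0, hr1⟩ := ruin_ratio_mem hq0 hq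
  have hnn (k d : ℕ) : 0 ≤ (k : ℝ) * firstPassage q k d :=
    mul_nonneg k.cast_nonneg (firstPassage_nonneg hq0.le (by linarith) k d)
  have hs (d : ℕ) : Summable (fun k : ℕ => (k : ℝ) * firstPassage q k d) :=
    summable_of_sum_range_le (fun k => hnn k d) fun N => sum_mul_firstPassage_le hq0 hq N d
  have hle (d : ℕ) : ∑' k : ℕ, (k : ℝ) * firstPassage q k d ≤
      (d : ℝ) * (q / (1 - q)) ^ d / (1 - 2 * q) :=
    (hs d).tsum_le_of_sum_range_le fun N => sum_mul_firstPassage_le hq0 hq N d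
  have hlim := (tendsto_self_mul_const_pow_of_lt_one hr0.le hr1).div_const (1 - 2 * q)
  rw [zero_div] at hlim
  have he := eq_zero_of_ruin_recurrence hq0 hq
    (e := fun d : ℕ => (d : ℝ) * (q / (1 - q)) ^ d / (1 - 2 * q) -
      ∑' k : ℕ, (k : ℝ) * firstPassage q k d) ?_ (fun d => ?_) ?_ d
  · rw [sub_eq_zero.1 he]; exact (hs d).hasSum
  · rw [(hs 0).tsum_eq_zero_add]; simp [firstPassage]
  · have hstep : (∑' k : ℕ, (k : ℝ) * firstPassage q k (d + 1)) =
        q * (∑' k : ℕ, (k : ℝ) * firstPassage q k d) +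
        (1 - q) * (∑' k : ℕ, (k : ℝ) * firstPassage q k (d + 2)) + (q / (1 - q)) ^ (d + 1) := by
      have h1 := hasSum_firstPassage hq0 hq (d + 1)
      rw [← hasSum_nat_add_iff' 1] at h1
      simp only [Finset.range_one, Finset.sum_singleton, firstPassage, sub_zero] at h1
      rw [(hs (d + 1)).tsum_eq_zero_add]
      simp only [firstPassage, mul_zero, zero_add]
      refine HasSum.tsum_eq ?_
      convert! (((hs d).hasSum.mul_left q).add ((hs (d + 2)).hasSum.mul_left (1 - q))).add h1
        using 2 with k
      push_cast; ring
    rw [hstep, ruin_mean_recurrence hq]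
    ring
  · exact squeeze_zero (fun d => sub_nonneg.2 (hle d))
      (fun d => sub_le_self _ (tsum_nonneg fun k => hnn k d)) hlim

/-! ### Paths -/

/-- The match `s` from goal number `m` on. -/
def shift (m : ℕ) (s : ℕ → Bool) : ℕ → Bool := fun k => s (m + k)

/-- In the match `s`, team B first makes up a deficit of `d` goals after exactly `k` goals. -/
def FirstTie (s : ℕ → Bool) (d k : ℕ) : Prop :=
  goalsB s k = goalsG s k + d ∧ ∀ i < k, goalsB s i ≠ goalsG s i + d

/-- Phase I of the match `s` to `m + 1` goals ends with goal number `m + j`, when team B has `j`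
goals. -/
def EndsPhaseOne (s : ℕ → Bool) (m j : ℕ) : Prop :=
  goalsB s (m + j) = j ∧ s (m + j) = false

lemma goalsB_zero (s : ℕ → Bool) : goalsB s 0 = 0 := by simp [goalsB]

lemma goalsG_zero (s : ℕ → Bool) : goalsG s 0 = 0 := by simp [goalsG]

lemma goalsB_succ (s : ℕ → Bool) (t : ℕ) :
    goalsB s (t + 1) = goalsB s t + if s t = true then 1 else 0 := by
  rw [goalsB, goalsB, Finset.range_add_one, Finset.filter_insert]
  split_ifs <;> simp

lemma goalsG_succ (s : ℕ → Bool) (t : ℕ) :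
    goalsG s (t + 1) = goalsG s t + if s t = false then 1 else 0 := by
  rw [goalsG, goalsG, Finset.range_add_one, Finset.filter_insert]
  split_ifs <;> simp

lemma goalsB_add_goalsG (s : ℕ → Bool) (t : ℕ) : goalsB s t + goalsG s t = t := by
  induction t with
  | zero => simp [goalsB_zero, goalsG_zero]
  | succ t ih =>
    rw [goalsB_succ, goalsG_succ]
    cases s t <;> simp <;> omega

lemma goalsB_add (s : ℕ → Bool) (m k : ℕ) :
    goalsB s (m + k) = goalsB s m + goalsB (shift m s) k := by
  induction k with
  | zero => simp [goalsB_zero]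
  | succ k ih => rw [← add_assoc, goalsB_succ, goalsB_succ, ih, shift, add_assoc]

lemma goalsG_add (s : ℕ → Bool) (m k : ℕ) :
    goalsG s (m + k) = goalsG s m + goalsG (shift m s) k := by
  induction k with
  | zero => simp [goalsG_zero]
  | succ k ih => rw [← add_assoc, goalsG_succ, goalsG_succ, ih, shift, add_assoc]

lemma goalsG_mono (s : ℕ → Bool) : Monotone (goalsG s) :=
  monotone_nat_of_le_succ fun t => by rw [goalsG_succ]; omega

lemma goalsB_congr {s s' : ℕ → Bool} {t : ℕ} (h : ∀ i < t, s i = s' i) :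
    goalsB s t = goalsB s' t := by
  rw [goalsB, goalsB]
  congr 1
  exact Finset.filter_congr fun i hi => by rw [h i (Finset.mem_range.1 hi)]

lemma goalsG_congr {s s' : ℕ → Bool} {t : ℕ} (h : ∀ i < t, s i = s' i) :
    goalsG s t = goalsG s' t := by
  rw [goalsG, goalsG]
  congr 1
  exact Finset.filter_congr fun i hi => by rw [h i (Finset.mem_range.1 hi)]

lemma FirstTie.unique {s : ℕ → Bool} {d k l : ℕ} (hk : FirstTie s d k) (hl : FirstTie s d l) :
    k = l := by
  rcases lt_trichotomy k l with h | h | h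
  · exact absurd hk.1 (hl.2 k h)
  · exact h
  · exact absurd hl.1 (hk.2 l h)

lemma exists_firstTie {s : ℕ → Bool} {d k : ℕ} (h : goalsB s k = goalsG s k + d) :
    ∃ l, FirstTie s d l := by
  classical
  have hex : ∃ l, goalsB s l = goalsG s l + d := ⟨k, h⟩
  exact ⟨Nat.find hex, Nat.find_spec hex, fun i hi => Nat.find_min hex hi⟩

lemma firstTie_zero_iff (s : ℕ → Bool) (k : ℕ) : FirstTie s 0 k ↔ k = 0 := by
  have h0 : FirstTie s 0 0 := ⟨by simp [goalsB_zero, goalsG_zero], by simp⟩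
  exact ⟨fun h => h.unique h0, fun h => h ▸ h0⟩

/-- A goal of B lowers the deficit d + 1 to d and a goal of G raises it to d + 2. A tie at time 0 is
impossible because the deficit is positive, so that condition drops out. -/
lemma firstTie_succ_iff (s : ℕ → Bool) (d k : ℕ) :
    FirstTie s (d + 1) (k + 1) ↔
      (s 0 = true ∧ FirstTie (shift 1 s) d k) ∨
        (s 0 = false ∧ FirstTie (shift 1 s) (d + 2) k) := by
  have hB (i : ℕ) : goalsB s (i + 1) = (if s 0 = true then 1 else 0) + goalsB (shift 1 s) i := by
    rw [add_comm i 1, goalsB_add, goalsB_succ, goalsB_zero, zero_add]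
  have hG (i : ℕ) : goalsG s (i + 1) = (if s 0 = false then 1 else 0) + goalsG (shift 1 s) i := by
    rw [add_comm i 1, goalsG_add, goalsG_succ, goalsG_zero, zero_add]
  have hlt (P : ℕ → Prop) (h0 : P 0) : (∀ i < k + 1, P i) ↔ ∀ i < k, P (i + 1) := by
    refine ⟨fun h i hi => h _ (by omega), fun h i hi => ?_⟩
    cases i with
    | zero => exact h0
    | succ i => exact h i (by omega)
  rw [FirstTie, hlt _ (by simp [goalsB_zero])]
  cases h : s 0 <;> simp only [FirstTie, hB, hG, h] <;> simp <;>
    refine and_congr (by omega) (forall₂_congr fun i _ => not_congr (by omega))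

lemma EndsPhaseOne.goalsG_eq {s : ℕ → Bool} {m j : ℕ} (h : EndsPhaseOne s m j) :
    goalsG s (m + j) = m := by
  have := goalsB_add_goalsG s (m + j)
  have := h.1
  omega

lemma EndsPhaseOne.goalsG_succ_eq {s : ℕ → Bool} {m j : ℕ} (h : EndsPhaseOne s m j) :
    goalsG s (m + j + 1) = m + 1 := by
  rw [goalsG_succ, h.goalsG_eq, if_pos h.2]

lemma EndsPhaseOne.goalsB_succ_eq {s : ℕ → Bool} {m j : ℕ} (h : EndsPhaseOne s m j) :
    goalsB s (m + j + 1) = j := by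
  rw [goalsB_succ, h.1, if_neg (by simp [h.2]), add_zero]

lemma EndsPhaseOne.phaseOneEnd_eq {s : ℕ → Bool} {m j : ℕ} (h : EndsPhaseOne s m j) :
    phaseOneEnd s (m + 1) = m + j + 1 := by
  refine le_antisymm (Nat.sInf_le h.goalsG_succ_eq) ?_
  refine le_csInf ⟨_, h.goalsG_succ_eq⟩ fun t ht => ?_
  by_contra! hlt
  have := goalsG_mono s (Nat.lt_succ_iff.1 hlt)
  rw [h.goalsG_eq, ht] at this
  omega

/-- At the first time G has m + 1 goals, the goal just scored is one of G; j counts the goals of B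
before it. -/
lemma exists_endsPhaseOne {s : ℕ → Bool} {m : ℕ} (h : ∃ t, goalsG s t = m + 1) :
    ∃ j, EndsPhaseOne s m j := by
  classical
  have hspec := Nat.find_spec h
  have hmin := fun t => @Nat.find_min _ _ h t
  generalize Nat.find h = t at hspec hmin
  cases t with
  | zero => simp [goalsG_zero] at hspec
  | succ t =>
    have h1 := hmin t (Nat.lt_succ_self t)
    rw [goalsG_succ] at hspec
    have h2 := goalsB_add_goalsG s t
    cases hst : s t with
    | true => simp [hst] at hspec; omega
    | false =>
      simp only [hst, if_true] at hspec
      refine ⟨goalsB s t, ?_⟩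
      have : m + goalsB s t = t := by omega
      rw [EndsPhaseOne, this]
      exact ⟨rfl, hst⟩

lemma EndsPhaseOne.unique {s : ℕ → Bool} {m j l : ℕ} (hj : EndsPhaseOne s m j)
    (hl : EndsPhaseOne s m l) : j = l := by
  have h1 := hj.phaseOneEnd_eq
  have h2 := hl.phaseOneEnd_eq
  omega

/-- Phase I ends when team B has `j` goals, and then team B wins after exactly `k` goals of
Phase II. -/
def WinsAfter (s : ℕ → Bool) (m j k : ℕ) : Prop :=
  EndsPhaseOne s m j ∧ FirstTie (shift (m + j + 1) s) (m + 1 - j) k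

lemma EndsPhaseOne.tie_iff {s : ℕ → Bool} {m j : ℕ} (h : EndsPhaseOne s m j) (hj : j ≤ m)
    (k : ℕ) : goalsB s (phaseOneEnd s (m + 1) + k) = goalsG s (phaseOneEnd s (m + 1) + k) ↔
      goalsB (shift (m + j + 1) s) k = goalsG (shift (m + j + 1) s) k + (m + 1 - j) := by
  rw [h.phaseOneEnd_eq, goalsB_add, goalsG_add, h.goalsB_succ_eq, h.goalsG_succ_eq]
  omega

theorem teamBWins_iff (s : ℕ → Bool) (m : ℕ) :
    TeamBWins s (m + 1) ↔ ∃ j k, WinsAfter s m j k := by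
  constructor
  · rintro ⟨h, hw⟩
    obtain ⟨j, hj⟩ := exists_endsPhaseOne h
    by_cases hjm : m + 1 ≤ j
    · refine ⟨j, 0, hj, ?_⟩
      -- An immediate win is a first tie at time 0, because the truncated deficit m + 1 - j is 0.
      -- Both ways of winning are thus covered by `WinsAfter`.
      rw [Nat.sub_eq_zero_of_le hjm, firstTie_zero_iff]
    · rw [hj.phaseOneEnd_eq, hj.goalsB_succ_eq, ← hj.phaseOneEnd_eq] at hw
      obtain ⟨k, hk⟩ := hw.resolve_left hjm
      obtain ⟨l, hl⟩ := exists_firstTie ((hj.tie_iff (by omega) k).1 hk)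
      exact ⟨j, l, hj, hl⟩
  · rintro ⟨j, k, hj, hk⟩
    refine ⟨⟨_, hj.goalsG_succ_eq⟩, ?_⟩
    by_cases hjm : m + 1 ≤ j
    · left
      rwa [hj.phaseOneEnd_eq, hj.goalsB_succ_eq]
    · exact Or.inr ⟨k, (hj.tie_iff (by omega) k).2 hk.1⟩

theorem WinsAfter.phaseTwoDuration_eq {s : ℕ → Bool} {m j k : ℕ} (h : WinsAfter s m j k) :
    phaseTwoDuration s (m + 1) = k := by
  obtain ⟨hj, hk⟩ := h
  rw [phaseTwoDuration]
  by_cases hjm : m + 1 ≤ j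
  · rw [if_pos (by rwa [hj.phaseOneEnd_eq, hj.goalsB_succ_eq])]
    rw [Nat.sub_eq_zero_of_le hjm, firstTie_zero_iff] at hk
    exact hk.symm
  · rw [if_neg (by rwa [hj.phaseOneEnd_eq, hj.goalsB_succ_eq])]
    simp only [hj.tie_iff (not_lt.1 hjm)]
    refine le_antisymm (Nat.sInf_le hk.1) (le_csInf ⟨k, hk.1⟩ fun l hl => ?_)
    by_contra! hlt
    exact hk.2 l hlt hl

lemma WinsAfter.unique {s : ℕ → Bool} {m j k j' k' : ℕ} (h : WinsAfter s m j k)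
    (h' : WinsAfter s m j' k') : j = j' ∧ k = k' := by
  obtain rfl := h.1.unique h'.1
  exact ⟨rfl, h.2.unique h'.2⟩

lemma dependsOn_goalsB (t : ℕ) (b : ℕ) :
    DependsOn (fun s => goalsB s t = b) (Finset.range t : Set ℕ) := by
  intro s s' h
  simp only [goalsB_congr fun i hi => h i (by simpa using hi)]

lemma dependsOn_apply (t : ℕ) (b : Bool) :
    DependsOn (fun s : ℕ → Bool => s t = b) (({t} : Finset ℕ) : Set ℕ) := by
  intro s s' h
  simp only [h t (by simp)]

lemma dependsOn_endsPhaseOne (m j : ℕ) :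
    DependsOn (fun s => EndsPhaseOne s m j) (Finset.range (m + j + 1) : Set ℕ) := by
  intro s s' h
  have h1 : ∀ i < m + j + 1, s i = s' i := fun i hi => h i (by simpa using hi)
  have h2 : goalsB s (m + j) = goalsB s' (m + j) := goalsB_congr fun i hi => h1 i (by omega)
  simp only [EndsPhaseOne, h1 _ (Nat.lt_succ_self _), h2]

lemma dependsOn_firstTie (m d k : ℕ) :
    DependsOn (fun s => FirstTie (shift m s) d k) (Finset.Ico m (m + k) : Set ℕ) := by
  intro s s' h
  have h1 : ∀ l ≤ k, ∀ i < l, shift m s i = shift m s' i := fun l hl i hi =>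
    h (m + i) (by simp; omega)
  simp only [FirstTie, goalsB_congr (h1 k le_rfl), goalsG_congr (h1 k le_rfl)]
  refine congrArg _ (propext (forall₂_congr fun i hi => ?_))
  rw [goalsB_congr (h1 i hi.le), goalsG_congr (h1 i hi.le)]

/-! ### Probabilities of events that depend on finitely many goals -/

section FiniteEvents

variable {Ω : Type*}

/-- The path of the random match `X` at `ω`. -/
def path (X : ℕ → Ω → Bool) (ω : Ω) : ℕ → Bool := fun k => X k ω

/-- Extension of finitely many goals to a match. -/
def extendFalse (S : Finset ℕ) (r : S → Bool) : ℕ → Bool :=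
  fun i => if h : i ∈ S then r ⟨i, h⟩ else false

/-- An event determined by the goals in S is a preimage of a set in the finite type `S → Bool`,
where every set is measurable. Measurability and independence over disjoint sets of goals both
follow from this. -/
lemma setOf_path_eq_preimage (X : ℕ → Ω → Bool) {P : (ℕ → Bool) → Prop} {S : Finset ℕ}
    (hP : DependsOn P (S : Set ℕ)) :
    {ω | P (path X ω)} =
      (fun ω (i : S) => X i ω) ⁻¹' {r : S → Bool | P (extendFalse S r)} := by
  ext ω
  simp only [Set.mem_ofPred_eq, Set.mem_preimage]
  rw [hP fun i hi => ?_]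
  simp [extendFalse, path, Finset.mem_coe.1 hi]

variable [MeasurableSpace Ω]

lemma measurableSet_path {X : ℕ → Ω → Bool} (hmeas : ∀ k, Measurable (X k))
    {P : (ℕ → Bool) → Prop} {S : Finset ℕ} (hP : DependsOn P (S : Set ℕ)) :
    MeasurableSet {ω | P (path X ω)} := by
  rw [setOf_path_eq_preimage X hP]
  have h : Measurable (fun ω (i : S) => X i ω) := measurable_pi_lambda _ fun i => hmeas i
  exact h (Set.toFinite _).measurableSet

variable {μ : Measure Ω}

lemma measureReal_path_and {X : ℕ → Ω → Bool} (hmeas : ∀ k, Measurable (X k))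
    (hindep : iIndepFun X μ) {P Q : (ℕ → Bool) → Prop} {S T : Finset ℕ}
    (hP : DependsOn P (S : Set ℕ)) (hQ : DependsOn Q (T : Set ℕ)) (hST : Disjoint S T) :
    μ.real {ω | P (path X ω) ∧ Q (path X ω)} =
      μ.real {ω | P (path X ω)} * μ.real {ω | Q (path X ω)} := by
  have h : {ω | P (path X ω) ∧ Q (path X ω)} = {ω | P (path X ω)} ∩ {ω | Q (path X ω)} := rfl
  rw [h, setOf_path_eq_preimage X hP, setOf_path_eq_preimage X hQ, measureReal_def,
    (hindep.indepFun_finset S T hST hmeas).measure_inter_preimage_eq_mul _ _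
      (Set.toFinite _).measurableSet (Set.toFinite _).measurableSet, ENNReal.toReal_mul]
  rfl

lemma measureReal_path_or [IsFiniteMeasure μ] {X : ℕ → Ω → Bool}
    (hmeas : ∀ k, Measurable (X k)) {P Q : (ℕ → Bool) → Prop} {T : Finset ℕ}
    (hQ : DependsOn Q (T : Set ℕ)) (hPQ : ∀ s, P s → ¬ Q s) :
    μ.real {ω | P (path X ω) ∨ Q (path X ω)} =
      μ.real {ω | P (path X ω)} + μ.real {ω | Q (path X ω)} :=
  measureReal_union (Set.disjoint_left.2 fun _ h1 h2 => hPQ _ h1 h2) (measurableSet_path hmeas hQ)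

lemma DependsOn.and {P Q : (ℕ → Bool) → Prop} {S : Set ℕ} (hP : DependsOn P S)
    (hQ : DependsOn Q S) : DependsOn (fun s => P s ∧ Q s) S :=
  fun _ _ h => by simp only [hP h, hQ h]

lemma DependsOn.of_subset {P : (ℕ → Bool) → Prop} {S T : Finset ℕ}
    (hP : DependsOn P (S : Set ℕ)) (h : S ⊆ T) : DependsOn P (T : Set ℕ) :=
  fun _ _ h' => hP fun i hi => h' i (h hi)

section Law

variable [IsProbabilityMeasure μ] {q : ℝ} {X : ℕ → Ω → Bool}

lemma measureReal_apply_false (hmeas : ∀ k, Measurable (X k))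
    (hlaw : ∀ k, μ.real {ω | X k ω = true} = q) (t : ℕ) :
    μ.real {ω | path X ω t = false} = 1 - q := by
  have h : {ω | path X ω t = false} = (X t ⁻¹' {true})ᶜ := by
    ext ω; simp [path]
  rw [h, measureReal_compl (hmeas t (measurableSet_singleton true)), probReal_univ]
  exact congrArg _ (hlaw t)

/-- The number of goals of team B is binomially distributed. -/
lemma measureReal_goalsB_eq (hmeas : ∀ k, Measurable (X k)) (hindep : iIndepFun X μ)
    (hlaw : ∀ k, μ.real {ω | X k ω = true} = q) (hq : q < 1) (t b : ℕ) :
    μ.real {ω | goalsB (path X ω) t = b} = t.choose b * (1 - q) ^ t * (q / (1 - q)) ^ b := by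
  have hp : 1 - q ≠ 0 := by linarith
  have hstep (t b : ℕ) (c : Bool) :
      μ.real {ω | goalsB (path X ω) t = b ∧ path X ω t = c} =
        μ.real {ω | goalsB (path X ω) t = b} * μ.real {ω | path X ω t = c} :=
    measureReal_path_and hmeas hindep (dependsOn_goalsB t b) (dependsOn_apply t c) (by simp)
  induction t generalizing b with
  | zero =>
    cases b <;> simp [goalsB_zero]
  | succ t ih =>
    cases b with
    | zero =>
      have h : {ω | goalsB (path X ω) (t + 1) = 0} =
          {ω | goalsB (path X ω) t = 0 ∧ path X ω t = false} := by
        ext ω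
        simp only [Set.mem_ofPred_eq, goalsB_succ]
        cases path X ω t <;> simp
      rw [h, hstep, ih, measureReal_apply_false hmeas hlaw]
      simp [pow_succ]
    | succ b =>
      have h : {ω | goalsB (path X ω) (t + 1) = b + 1} =
          {ω | (goalsB (path X ω) t = b ∧ path X ω t = true) ∨
            (goalsB (path X ω) t = b + 1 ∧ path X ω t = false)} := by
        ext ω
        simp only [Set.mem_ofPred_eq, goalsB_succ]
        cases path X ω t <;> simp
      rw [h, measureReal_path_or hmeas (P := fun s => goalsB s t = b ∧ s t = true)
        (Q := fun s => goalsB s t = b + 1 ∧ s t = false) (T := Finset.range (t + 1))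
        (DependsOn.and (DependsOn.of_subset (dependsOn_goalsB t (b + 1)) (by simp))
          (DependsOn.of_subset (dependsOn_apply t false) (by simp)))
        (fun s h1 h2 => by simp [h1.2] at h2), hstep, hstep, ih, ih,
        measureReal_apply_false hmeas hlaw, show μ.real {ω | path X ω _ = true} = q from hlaw _,
        Nat.choose_succ_succ]
      push_cast
      -- Powers of q/(1-q) keep the truncated exponent t - b out of the binomial law; besides
      -- Pascal's rule only this relation is used.
      have hr : (1 - q) * (q / (1 - q)) = q := by field_simp
      generalize q / (1 - q) = r at hr
      linear_combination (-(t.choose b : ℝ) * (1 - q) ^ t * r ^ b) * hr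

lemma measureReal_endsPhaseOne (hmeas : ∀ k, Measurable (X k)) (hindep : iIndepFun X μ)
    (hlaw : ∀ k, μ.real {ω | X k ω = true} = q) (hq : q < 1) (m j : ℕ) :
    μ.real {ω | EndsPhaseOne (path X ω) m j} =
      ((m + j).choose j : ℝ) * (1 - q) ^ (m + 1) * q ^ j := by
  have hp : 1 - q ≠ 0 := by linarith
  have h := measureReal_path_and hmeas hindep (dependsOn_goalsB (m + j) j)
    (dependsOn_apply (m + j) false) (by simp)
  simp only [EndsPhaseOne]
  rw [h, measureReal_goalsB_eq hmeas hindep hlaw hq, measureReal_apply_false hmeas hlaw, div_pow,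
    pow_add, pow_succ (1 - q) m]
  field_simp

lemma measureReal_firstTie (hmeas : ∀ k, Measurable (X k)) (hindep : iIndepFun X μ)
    (hlaw : ∀ k, μ.real {ω | X k ω = true} = q) (k d m : ℕ) :
    μ.real {ω | FirstTie (shift m (path X ω)) d k} = firstPassage q k d := by
  -- The starting time m must vary: conditioning on goal number m restarts the walk at m + 1.
  induction k generalizing d m with
  | zero =>
    cases d <;> simp [FirstTie, goalsB_zero, goalsG_zero, firstPassage]
  | succ k ih =>
    cases d with
    | zero => simp [firstTie_zero_iff, firstPassage]
    | succ d =>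
      have hshift (s : ℕ → Bool) : shift 1 (shift m s) = shift (m + 1) s := by
        ext i; simp [shift, add_assoc]
      have h0 (s : ℕ → Bool) : shift m s 0 = s m := by simp [shift]
      have hstep (d' : ℕ) (c : Bool) :
          μ.real {ω | path X ω m = c ∧ FirstTie (shift (m + 1) (path X ω)) d' k} =
          μ.real {ω | path X ω m = c} * μ.real {ω | FirstTie (shift (m + 1) (path X ω)) d' k} :=
        measureReal_path_and hmeas hindep (dependsOn_apply m c) (dependsOn_firstTie (m + 1) d' k)
          (by simp)
      simp only [firstTie_succ_iff, hshift, h0]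
      rw [measureReal_path_or hmeas
        (P := fun s => s m = true ∧ FirstTie (shift (m + 1) s) d k)
        (Q := fun s => s m = false ∧ FirstTie (shift (m + 1) s) (d + 2) k)
        (T := Finset.Ico m (m + 1 + k))
        (DependsOn.and (DependsOn.of_subset (dependsOn_apply m false) (by simp; omega))
          (DependsOn.of_subset (dependsOn_firstTie (m + 1) (d + 2) k)
            (Finset.Ico_subset_Ico_left (by omega))))
        (fun s h1 h2 => by simp [h1.1] at h2), hstep, hstep, ih, ih,
        measureReal_apply_false hmeas hlaw, show μ.real {ω | path X ω _ = true} = q from hlaw _,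
        firstPassage]

lemma dependsOn_winsAfter (m j k : ℕ) :
    DependsOn (fun s => WinsAfter s m j k) (Finset.range (m + j + 1 + k) : Set ℕ) :=
  DependsOn.and (DependsOn.of_subset (dependsOn_endsPhaseOne m j) (by simp))
    (DependsOn.of_subset (dependsOn_firstTie (m + j + 1) (m + 1 - j) k)
      (fun i hi => by simp at hi ⊢; omega))

lemma measureReal_winsAfter (hmeas : ∀ k, Measurable (X k)) (hindep : iIndepFun X μ)
    (hlaw : ∀ k, μ.real {ω | X k ω = true} = q) (hq : q < 1) (m j k : ℕ) :
    μ.real {ω | WinsAfter (path X ω) m j k} =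
      ((m + j).choose j : ℝ) * (1 - q) ^ (m + 1) * q ^ j * firstPassage q k (m + 1 - j) := by
  rw [← measureReal_endsPhaseOne hmeas hindep hlaw hq,
    ← measureReal_firstTie hmeas hindep hlaw k (m + 1 - j) (m + j + 1)]
  refine measureReal_path_and hmeas hindep (dependsOn_endsPhaseOne m j)
    (dependsOn_firstTie (m + j + 1) (m + 1 - j) k) ?_
  rw [Finset.disjoint_left]
  intro i hi
  simp at hi ⊢
  omega

end Law

end FiniteEvents

variable {Ω : Type*}

/-! ### The expected duration in closed form -/

/-- Tonelli for series: nonnegativity turns the iterated sum into an unconditional double sum. -/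
lemma hasSum_prod_of_nonneg {f : ℕ × ℕ → ℝ} (hf : ∀ i, 0 ≤ f i) {g : ℕ → ℝ} {G : ℝ}
    (hg : ∀ j, HasSum (fun k => f (j, k)) (g j)) (hG : HasSum g G) : HasSum f G := by
  have hs : Summable f := by
    refine (summable_prod_of_nonneg hf).2 ⟨fun j => (hg j).summable, ?_⟩
    simpa only [(hg _).tsum_eq] using hG.summable
  have h := hs.hasSum.prod_fiberwise hg
  rw [hG.unique h]
  exact hs.hasSum

lemma mul_ruin_pow {q : ℝ} (hq : q < 1) {m j : ℕ} (hj : j ≤ m) :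
    (1 - q) ^ (m + 1) * q ^ j * (q / (1 - q)) ^ (m + 1 - j) = q ^ (m + 1) * (1 - q) ^ j := by
  have hp : 1 - q ≠ 0 := by linarith
  obtain ⟨l, hl⟩ := Nat.exists_eq_add_of_le (Nat.le_succ_of_le hj)
  rw [Nat.succ_eq_add_one] at hl
  rw [hl, Nat.add_sub_cancel_left, div_pow, pow_add, pow_add]
  field_simp

lemma hasSum_negBin {q : ℝ} (hq0 : 0 < q) (hq : q < 1) (m : ℕ) :
    HasSum (fun j => ((m + j).choose j : ℝ) * (1 - q) ^ (m + 1) * q ^ j) 1 := by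
  have hp : 0 < 1 - q := by linarith
  have h := (hasSum_choose_mul_geometric_of_norm_lt_one m (r := q)
    (by rwa [Real.norm_of_nonneg hq0.le])).mul_left ((1 - q) ^ (m + 1))
  rw [mul_one_div_cancel (by positivity)] at h
  convert! h using 2 with j
  have : (m + j).choose j = (j + m).choose m := by
    rw [add_comm, Nat.choose_symm_add]
  rw [this]; ring

lemma hasSum_win {q : ℝ} (hq0 : 0 < q) (hq : q < 1) (m : ℕ) :
    HasSum (fun j => ((m + j).choose j : ℝ) * (1 - q) ^ (m + 1) * q ^ j *
      (q / (1 - q)) ^ (m + 1 - j)) (2 * q ^ (m + 1) * halfSum (1 - q) m) := by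
  have h1 := hasSum_negBin hq0 hq m
  -- Compared with the full negative binomial law, of mass 1, the series changes only for j ≤ m. The
  -- infinite tail of immediate wins is therefore never summed directly.
  have h2 : HasSum (fun j => ((m + j).choose j : ℝ) * (1 - q) ^ (m + 1) * q ^ j *
      (q / (1 - q)) ^ (m + 1 - j) - ((m + j).choose j : ℝ) * (1 - q) ^ (m + 1) * q ^ j) _ :=
    hasSum_sum_of_ne_finset_zero (s := Finset.range (m + 1)) fun j hj => by
      rw [Finset.mem_range, not_lt] at hj
      rw [Nat.sub_eq_zero_of_le hj, pow_zero, mul_one, sub_self]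
  have h3 : ∑ j ∈ Finset.range (m + 1), (((m + j).choose j : ℝ) * (1 - q) ^ (m + 1) * q ^ j *
      (q / (1 - q)) ^ (m + 1 - j) - ((m + j).choose j : ℝ) * (1 - q) ^ (m + 1) * q ^ j) =
      q ^ (m + 1) * halfSum (1 - q) m - (1 - q) ^ (m + 1) * halfSum q m := by
    rw [halfSum, halfSum, negBinSum, negBinSum, Finset.mul_sum, Finset.mul_sum,
      ← Finset.sum_sub_distrib]
    refine Finset.sum_congr rfl fun j hj => ?_
    have := mul_ruin_pow hq (Nat.lt_succ_iff.1 (Finset.mem_range.1 hj))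
    linear_combination ((m + j).choose j : ℝ) * this
  rw [h3] at h2
  have h4 := halfSum_symm (sub_add_cancel 1 q) m
  have h5 := h1.add h2
  rw [show 1 + (q ^ (m + 1) * halfSum (1 - q) m - (1 - q) ^ (m + 1) * halfSum q m) =
    2 * q ^ (m + 1) * halfSum (1 - q) m by linear_combination -h4] at h5
  convert! h5 using 2
  ring

lemma hasSum_duration {q : ℝ} (hq : q < 1) (m : ℕ) :
    HasSum (fun j => ((m + j).choose j : ℝ) * (1 - q) ^ (m + 1) * q ^ j *
      (((m + 1 - j : ℕ) : ℝ) * (q / (1 - q)) ^ (m + 1 - j) / (1 - 2 * q)))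
      (q ^ (m + 1) / (1 - 2 * q) * ∑ j ∈ Finset.range (m + 1),
        ((m : ℝ) + 1 - j) * (((m + j).choose j : ℝ) * (1 - q) ^ j)) := by
  have h : HasSum (fun j => ((m + j).choose j : ℝ) * (1 - q) ^ (m + 1) * q ^ j *
      (((m + 1 - j : ℕ) : ℝ) * (q / (1 - q)) ^ (m + 1 - j) / (1 - 2 * q))) _ :=
    hasSum_sum_of_ne_finset_zero (s := Finset.range (m + 1)) fun j hj => by
      rw [Finset.mem_range, not_lt] at hj
      rw [Nat.sub_eq_zero_of_le hj]; simp
  convert! h using 1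
  rw [Finset.mul_sum]
  refine Finset.sum_congr rfl fun j hj => ?_
  have hj' : j ≤ m := Nat.lt_succ_iff.1 (Finset.mem_range.1 hj)
  rw [Nat.cast_sub (by omega)]
  push_cast
  linear_combination (-((m + j).choose j : ℝ) * ((m : ℝ) + 1 - j) / (1 - 2 * q)) *
    mul_ruin_pow hq hj'

lemma winEvent_eq_iUnion (X : ℕ → Ω → Bool) (m : ℕ) :
    winEvent X (m + 1) = ⋃ i : ℕ × ℕ, {ω | WinsAfter (path X ω) m i.1 i.2} := by
  ext ω
  simp only [Set.mem_iUnion, Prod.exists]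
  exact teamBWins_iff _ m

lemma pairwise_disjoint_winsAfter (X : ℕ → Ω → Bool) (m : ℕ) :
    Pairwise (Function.onFun Disjoint
      fun i : ℕ × ℕ => {ω | WinsAfter (path X ω) m i.1 i.2}) := by
  intro i i' hne
  refine Set.disjoint_left.2 fun ω h h' => hne ?_
  obtain ⟨h1, h2⟩ := WinsAfter.unique h h'
  exact Prod.ext h1 h2

variable [MeasurableSpace Ω] {μ : Measure Ω} [IsProbabilityMeasure μ] {q : ℝ} {X : ℕ → Ω → Bool}

lemma measurableSet_winsAfter (hmeas : ∀ k, Measurable (X k)) (m : ℕ) (i : ℕ × ℕ) :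
    MeasurableSet {ω | WinsAfter (path X ω) m i.1 i.2} :=
  measurableSet_path hmeas (dependsOn_winsAfter m i.1 i.2)

theorem measureReal_winEvent (hq0 : 0 < q) (hq : q < 1 / 2) (hmeas : ∀ k, Measurable (X k))
    (hindep : iIndepFun X μ) (hlaw : ∀ k, μ.real {ω | X k ω = true} = q) (m : ℕ) :
    μ.real (winEvent X (m + 1)) = 2 * q ^ (m + 1) * halfSum (1 - q) m := by
  -- Countable additivity for real-valued measures, as integration of the constant 1.
  have h1 := hasSum_integral_iUnion (μ := μ) (f := fun _ => (1 : ℝ))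
    (fun i => measurableSet_winsAfter hmeas m i) (pairwise_disjoint_winsAfter X m)
    (integrable_const _).integrableOn
  rw [← winEvent_eq_iUnion] at h1
  simp only [setIntegral_const, smul_eq_mul, mul_one] at h1
  refine h1.unique (hasSum_prod_of_nonneg (fun i => measureReal_nonneg) (fun j => ?_)
    (hasSum_win hq0 (by linarith) m))
  simp only [measureReal_winsAfter hmeas hindep hlaw (by linarith : q < 1)]
  exact (hasSum_firstPassage hq0 hq _).mul_left _

lemma setIntegral_duration_winsAfter (hmeas : ∀ k, Measurable (X k)) (m : ℕ) (i : ℕ × ℕ) :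
    IntegrableOn (duration X (m + 1)) {ω | WinsAfter (path X ω) m i.1 i.2} μ ∧
    ∫ ω in {ω | WinsAfter (path X ω) m i.1 i.2}, duration X (m + 1) ω ∂μ =
      i.2 * μ.real {ω | WinsAfter (path X ω) m i.1 i.2} := by
  have hms := measurableSet_winsAfter hmeas m i
  have heq : Set.EqOn (duration X (m + 1)) (fun _ => (i.2 : ℝ))
      {ω | WinsAfter (path X ω) m i.1 i.2} := fun ω hω =>
    congrArg Nat.cast (WinsAfter.phaseTwoDuration_eq hω)
  refine ⟨(integrableOn_congr_fun heq hms).2 (integrable_const _).integrableOn, ?_⟩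
  rw [setIntegral_congr_fun hms heq, setIntegral_const, smul_eq_mul, mul_comm]

theorem setIntegral_duration (hq0 : 0 < q) (hq : q < 1 / 2) (hmeas : ∀ k, Measurable (X k))
    (hindep : iIndepFun X μ) (hlaw : ∀ k, μ.real {ω | X k ω = true} = q) (m : ℕ) :
    IntegrableOn (duration X (m + 1)) (winEvent X (m + 1)) μ ∧
    ∫ ω in winEvent X (m + 1), duration X (m + 1) ω ∂μ =
      q ^ (m + 1) / (1 - 2 * q) * ∑ j ∈ Finset.range (m + 1),
        ((m : ℝ) + 1 - j) * (((m + j).choose j : ℝ) * (1 - q) ^ j) := by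
  have hsum : HasSum (fun i : ℕ × ℕ => ∫ ω in {ω | WinsAfter (path X ω) m i.1 i.2},
      duration X (m + 1) ω ∂μ) (q ^ (m + 1) / (1 - 2 * q) * ∑ j ∈ Finset.range (m + 1),
        ((m : ℝ) + 1 - j) * (((m + j).choose j : ℝ) * (1 - q) ^ j)) := by
    refine hasSum_prod_of_nonneg (fun i => integral_nonneg fun ω => Nat.cast_nonneg _)
      (fun j => ?_) (hasSum_duration (by linarith) m)
    have h := (hasSum_mul_firstPassage hq0 hq (m + 1 - j)).mul_left
      (((m + j).choose j : ℝ) * (1 - q) ^ (m + 1) * q ^ j)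
    refine (congrArg (fun f => HasSum f _) (funext fun k => ?_)).mpr h
    refine (setIntegral_duration_winsAfter hmeas m (j, k)).2.trans ?_
    rw [measureReal_winsAfter hmeas hindep hlaw (by linarith : q < 1)]
    ring
  have hint : IntegrableOn (duration X (m + 1)) (winEvent X (m + 1)) μ := by
    rw [winEvent_eq_iUnion]
    -- The duration is nonnegative, so the integrals of its norm over the pieces are the terms
    -- already summed in `hsum`.
    refine integrableOn_iUnion_of_summable_integral_norm
      (fun i => (setIntegral_duration_winsAfter hmeas m i).1) ?_
    convert! hsum.summable using 4 with i ω
    exact Real.norm_of_nonneg (Nat.cast_nonneg _)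
  refine ⟨hint, ?_⟩
  rw [winEvent_eq_iUnion] at hint ⊢
  exact (hasSum_integral_iUnion (fun i => measurableSet_winsAfter hmeas m i)
    (pairwise_disjoint_winsAfter X m) hint).unique hsum

theorem expectedDuration_eq (hq0 : 0 < q) (hq : q < 1 / 2) (hmeas : ∀ k, Measurable (X k))
    (hindep : iIndepFun X μ) (hlaw : ∀ k, μ.real {ω | X k ω = true} = q) (m : ℕ) :
    expectedDuration μ X (m + 1) = meanDuration q m := by
  have hH := halfSum_pos (show 0 < 1 - q by linarith) m
  have hd : 0 < 1 - 2 * q := by linarith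
  rw [expectedDuration, ProbabilityTheory.cond, integral_smul_measure,
    (setIntegral_duration hq0 hq hmeas hindep hlaw m).2, ENNReal.toReal_inv, ← measureReal_def,
    measureReal_winEvent hq0 hq hmeas hindep hlaw m, meanDuration, smul_eq_mul]
  field_simp

lemma measure_winEvent_ne_zero (hq0 : 0 < q) (hq : q < 1 / 2) (hmeas : ∀ k, Measurable (X k))
    (hindep : iIndepFun X μ) (hlaw : ∀ k, μ.real {ω | X k ω = true} = q) (m : ℕ) :
    μ (winEvent X (m + 1)) ≠ 0 := by
  have hH := halfSum_pos (show 0 < 1 - q by linarith) m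
  intro h
  have h1 := measureReal_winEvent hq0 hq hmeas hindep hlaw m
  rw [measureReal_def, h, ENNReal.toReal_zero] at h1
  have : 0 < 2 * q ^ (m + 1) * halfSum (1 - q) m := by positivity
  linarith

lemma integrable_duration_cond (hq0 : 0 < q) (hq : q < 1 / 2) (hmeas : ∀ k, Measurable (X k))
    (hindep : iIndepFun X μ) (hlaw : ∀ k, μ.real {ω | X k ω = true} = q) (m : ℕ) :
    Integrable (duration X (m + 1)) (ProbabilityTheory.cond μ (winEvent X (m + 1))) :=
  Integrable.smul_measure (setIntegral_duration hq0 hq hmeas hindep hlaw m).1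
    (ENNReal.inv_ne_top.2 (measure_winEvent_ne_zero hq0 hq hmeas hindep hlaw m))

theorem expectedDuration_sub_isBigO (hq0 : 0 < q) (hq : q < 1 / 2)
    (hmeas : ∀ k, Measurable (X k)) (hindep : iIndepFun X μ)
    (hlaw : ∀ k, μ.real {ω | X k ω = true} = q) :
    (fun n : ℕ => expectedDuration μ X n - durationApprox q (1 / (n : ℝ)))
      =O[atTop] fun n : ℕ => 1 / (n : ℝ) ^ 5 := by
  obtain ⟨C, -, hC⟩ := exists_abs_meanDuration_sub_le hq0 hq
  refine IsBigO.of_bound C ?_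
  filter_upwards [eventually_ge_atTop 1] with n hn
  obtain ⟨m, rfl⟩ := Nat.exists_eq_add_of_le' hn
  rw [expectedDuration_eq hq0 hq hmeas hindep hlaw, Real.norm_eq_abs,
    Real.norm_of_nonneg (by positivity)]
  push_cast
  exact hC m

theorem tendsto_expectedDuration (hq0 : 0 < q) (hq : q < 1 / 2)
    (hmeas : ∀ k, Measurable (X k)) (hindep : iIndepFun X μ)
    (hlaw : ∀ k, μ.real {ω | X k ω = true} = q) :
    Tendsto (fun n : ℕ => expectedDuration μ X n) atTop (𝓝 ((1 - q) / (1 - 2 * q) ^ 2)) := by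
  have h0 : Tendsto (fun n : ℕ => 1 / (n : ℝ)) atTop (𝓝 0) := tendsto_one_div_atTop_nhds_zero_nat
  have h5 : Tendsto (fun n : ℕ => 1 / (n : ℝ) ^ 5) atTop (𝓝 0) := by
    simpa [one_div] using h0.pow 5
  have h1 := (expectedDuration_sub_isBigO hq0 hq hmeas hindep hlaw).trans_tendsto h5
  have hcont : Continuous (durationApprox q) := by unfold durationApprox; fun_prop
  have h2 := (hcont.tendsto 0).comp h0
  have h3 : durationApprox q 0 = (1 - q) / (1 - 2 * q) ^ 2 := by simp [durationApprox]
  rw [h3] at h2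
  simpa [Function.comp_def] using h1.add h2

end SoccerMatch

theorem theorem5 {Ω : Type*} [MeasurableSpace Ω] (μ : Measure Ω) [IsProbabilityMeasure μ]
    (q : ℝ) (hq0 : 0 < q) (hq : q < 1 / 2)
    (X : ℕ → Ω → Bool) (hmeas : ∀ k, Measurable (X k)) (hindep : iIndepFun X μ)
    (hlaw : ∀ k, μ.real {ω | X k ω = true} = q) :
    (∀ n : ℕ, 1 ≤ n → μ (SoccerMatch.winEvent X n) ≠ 0 ∧
      Integrable (SoccerMatch.duration X n)
        (ProbabilityTheory.cond μ (SoccerMatch.winEvent X n))) ∧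
    Tendsto (fun n : ℕ => SoccerMatch.expectedDuration μ X n) atTop
      (𝓝 ((1 - q) / (1 - 2 * q) ^ 2)) ∧
    (fun n : ℕ => SoccerMatch.expectedDuration μ X n -
        (1 - q) / (1 - 2 * q) ^ 2 *
          (1 - 1 / (1 - 2 * q) ^ 2 * (1 / (n : ℝ))
            - (6 * q ^ 2 - 6 * q - 1) / (1 - 2 * q) ^ 4 * (1 / (n : ℝ) ^ 2)
            - (36 * q ^ 4 - 72 * q ^ 3 + 12 * q ^ 2 + 24 * q + 1) / (1 - 2 * q) ^ 6
                * (1 / (n : ℝ) ^ 3)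
            - (216 * q ^ 6 - 648 * q ^ 5 + 276 * q ^ 4 + 528 * q ^ 3 - 306 * q ^ 2 - 66 * q - 1)
                / (1 - 2 * q) ^ 8 * (1 / (n : ℝ) ^ 4)))
      =O[atTop] (fun n : ℕ => 1 / (n : ℝ) ^ 5) := by
  refine ⟨fun n hn => ?_, SoccerMatch.tendsto_expectedDuration hq0 hq hmeas hindep hlaw, ?_⟩
  · obtain ⟨m, rfl⟩ := Nat.exists_eq_add_of_le' hn
    exact ⟨SoccerMatch.measure_winEvent_ne_zero hq0 hq hmeas hindep hlaw m,
      SoccerMatch.integrable_duration_cond hq0 hq hmeas hindep hlaw m⟩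
  · simpa only [SoccerMatch.durationApprox, one_div_pow] using
      SoccerMatch.expectedDuration_sub_isBigO hq0 hq hmeas hindep hlaw
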